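/- Let $\mathcal G=(B,\psi,A)$ be a finite quantum graph: $B$ is a finite-dimensional C*-algebra, $\psi$ is a (faithful) state on $B$ which is a $\delta$-form for some $\delta>0$, i.e. $mm^*=\delta^2\,\mathrm{id}_B$, where $m^*:B\to B\otimes B$ is the Hermitian adjoint of the multiplication $m: L^2(B\otimes B,\psi\otimes\psi)\to L^2(B,\psi)$, and $A:B\to B$ is a completely positive map with $m(A\otimes A)m^*=\delta^2A$. Put $\varepsilon_{\mathcal G}=\delta^{-2}(\mathrm{id}_B\otimes A)m^*(1_B)$, and let $E_{\mathcal G}=\mathrm{span}\{x\cdot\varepsilon_{\mathcal G}\cdot y: x,y\in B\}$ be the quantum edge correspondence, a sub-C*-correspondence of $B\otimes_\psi B$, whose operations are $a\cdot(x\otimes y)\cdot b=(ax)\otimes(yb)$ and $\langle x\otimes y\,|\,z\otimes w\rangle=\psi(x^*z)\,y^*w$. For a C*-correspondence $X$ over $B$ let $(\pi,t)$ be the universal covariant Toeplitz representation of $X$ in its Cuntz--Pimsner algebra $\mathcal O_X$, and let $t^k:X^{\otimes k}\to\mathcal O_X$ be given by $t^k(\xi_1\otimes\dots\otimes\xi_k)=t(\xi_1)\cdots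 t(\xi_k)$. A vector $\xi\in X^{\otimes m}$ is called non-returning if $t^m(\xi)^*\,t^n(\eta)\,t^m(\xi)=0$ whenever $0<n<m$ and $\eta\in X^{\otimes n}$. Let $1_c$ be a central projection in $B$ which is orthogonal to the range of $A$, i.e. $1_cA(x)=0$ for all $x\in B$. Then, for every $m\ge1$, \[ (1_c\cdot\varepsilon_{\mathcal G})\otimes\varepsilon_{\mathcal G}\otimes\varepsilon_{\mathcal G}\otimes\cdots\otimes\varepsilon_{\mathcal G}\in E_{\mathcal G}^{\otimes m} \] is a non-returning vector. -/

import Mathlib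

open scoped TensorProduct ComplexOrder ENNReal

universe u v

noncomputable section

/-! ## C*-correspondences over a finite-dimensional C*-algebra -/

/-- A finite-dimensional C*-correspondence over `B`: a finite-dimensional complex vector space with
a right `B`-action, a definite positive right `B`-valued inner product (conjugate linear in the
first variable, `B`-linear in the second) and a left action of `B` by adjointable operators, that is
a `*`-homomorphism from `B` to the adjointable operators. (Completeness is automatic in finite
dimension. Mathlib's `CStarModule` is not used: its axiom `⟪x, a • y⟫ = a * ⟪x, y⟫` is that of a
left module.) -/
structure Correspondence (B : Type u) [CStarAlgebra B] [PartialOrder B] [StarOrderedRing B] where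
  carrier : Type u
  [addCommGroup : AddCommGroup carrier]
  [module : Module ℂ carrier]
  [finiteDimensional : FiniteDimensional ℂ carrier]
  /-- the left action: `left b ξ` is `b · ξ` -/
  left : B →ₗ[ℂ] carrier →ₗ[ℂ] carrier
  /-- the right action: `right b ξ` is `ξ · b` -/
  right : B →ₗ[ℂ] carrier →ₗ[ℂ] carrier
  /-- the inner product `⟨ξ | η⟩` -/
  inner : carrier →ₗ⋆[ℂ] carrier →ₗ[ℂ] B
  left_mul : ∀ a b ξ, left (a * b) ξ = left a (left b ξ)
  right_mul : ∀ a b ξ, right (a * b) ξ = right b (right a ξ)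
  right_one : ∀ ξ, right 1 ξ = ξ
  inner_right : ∀ ξ η b, inner ξ (right b η) = inner ξ η * b
  star_inner : ∀ ξ η, star (inner ξ η) = inner η ξ
  inner_self_nonneg : ∀ ξ, 0 ≤ inner ξ ξ
  inner_self_eq_zero : ∀ ξ, inner ξ ξ = 0 → ξ = 0
  inner_left : ∀ b ξ η, inner (left b ξ) η = inner ξ (left (star b) η)

attribute [instance] Correspondence.addCommGroup Correspondence.module
  Correspondence.finiteDimensional

namespace Correspondence

variable {B : Type u} [CStarAlgebra B] [PartialOrder B] [StarOrderedRing B]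

instance : CoeSort (Correspondence B) (Type u) := ⟨Correspondence.carrier⟩

variable (X : Correspondence B)

/-- The rank-one operator `θ_{ξ,η} : μ ↦ ξ · ⟨η | μ⟩`. -/
def rankOne (ξ η : X) : X →ₗ[ℂ] X where
  toFun μ := X.right (X.inner η μ) ξ
  map_add' := by simp
  map_smul' := by simp

/-- The compact operators `K(X)`; as `X` is finite-dimensional, the span of the rank-one operators
is closed. -/
def compacts : Submodule ℂ (X →ₗ[ℂ] X) :=
  Submodule.span ℂ {T | ∃ ξ η : X, T = X.rankOne ξ η}

/-- The Katsura ideal `J_X = φ⁻¹(K(X)) ∩ (ker φ)^⊥`, where `φ` is the left action. -/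
def katsuraIdeal : Set B :=
  {b | X.left b ∈ X.compacts ∧ ∀ a, X.left a = 0 → a * b = 0}

/-! ### Toeplitz representations -/

/-- A Toeplitz representation `(π, t)` of `X` in a C*-algebra `D`. -/
structure ToeplitzRep (D : Type v) [NonUnitalCStarAlgebra D] where
  π : B →⋆ₙₐ[ℂ] D
  t : X →ₗ[ℂ] D
  left_covariant : ∀ b ξ, π b * t ξ = t (X.left b ξ)
  star_t_mul_t : ∀ ξ η, star (t ξ) * t η = π (X.inner ξ η)

namespace ToeplitzRep

variable {X} {D : Type v} [NonUnitalCStarAlgebra D] (r : X.ToeplitzRep D)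

theorem t_mul_π (ξ : X) (b : B) : r.t ξ * r.π b = r.t (X.right b ξ) := by
  rw [← sub_eq_zero, ← CStarRing.star_mul_self_eq_zero_iff]
  have h1 : X.inner (X.right b ξ) ξ = star b * X.inner ξ ξ := by
    rw [← X.star_inner, X.inner_right, star_mul, X.star_inner]
  have h2 : star (r.t ξ) * (r.t ξ * r.π b) = r.π (X.inner ξ ξ * b) := by
    rw [← mul_assoc, r.star_t_mul_t, map_mul]
  simp only [star_sub, star_mul, sub_mul, mul_sub, mul_assoc, h2, r.star_t_mul_t, X.inner_right]
  rw [← mul_assoc (star (r.t _)), r.star_t_mul_t, h1, ← map_star]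
  simp [mul_assoc]

theorem norm_t_sq_le (ξ : X) : ‖r.t ξ‖ ^ 2 ≤ ‖X.inner ξ ξ‖ := by
  rw [sq, ← CStarRing.norm_star_mul_self, r.star_t_mul_t]
  exact NonUnitalStarAlgHom.norm_apply_le r.π _

/-- The assignment `θ_{ξ,η} ↦ t(ξ) t(η)*` extends to a well-defined linear map `ψ_t` on `K(X)`. -/
theorem sum_t_mul_star_t_eq_zero {n : ℕ} (ξ η : Fin n → X)
    (h : ∑ i, X.rankOne (ξ i) (η i) = 0) : ∑ i, r.t (ξ i) * star (r.t (η i)) = 0 := by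
  rw [← CStarRing.mul_star_self_eq_zero_iff]
  have key : ∀ μ : X, (∑ i, r.t (ξ i) * star (r.t (η i))) * r.t μ = 0 := by
    intro μ
    simp only [Finset.sum_mul, mul_assoc, r.star_t_mul_t, r.t_mul_π]
    rw [← map_sum]
    have := congrArg (fun T : X →ₗ[ℂ] X => T μ) h
    simp only [LinearMap.sum_apply, LinearMap.zero_apply] at this
    exact (congrArg r.t this).trans (map_zero _)
  rw [star_sum, Finset.mul_sum]
  refine Finset.sum_eq_zero fun i _ => ?_
  rw [star_mul, star_star, ← mul_assoc, key, zero_mul]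

/-- `(π, t)` is covariant: `π(b) = ψ_t(φ(b))` for all `b ∈ J_X`, where `ψ_t` is the map on `K(X)`
with `ψ_t (∑ θ_{ξᵢ,ηᵢ}) = ∑ t(ξᵢ) t(ηᵢ)*`. -/
def IsCovariant : Prop :=
  ∀ b ∈ X.katsuraIdeal, ∀ (n : ℕ) (ξ η : Fin n → X),
    X.left b = ∑ i, X.rankOne (ξ i) (η i) → r.π b = ∑ i, r.t (ξ i) * star (r.t (η i))

end ToeplitzRep

/-! ### The Cuntz--Pimsner algebra -/

/-- A covariant Toeplitz representation of `X` in some C*-algebra. (The C*-algebra generated by the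
images of `B` and `X` always has a copy in the universe of `B` and `X`.) -/
structure CovariantRep where
  D : Type u
  [cstar : NonUnitalCStarAlgebra D]
  rep : X.ToeplitzRep D
  covariant : rep.IsCovariant

attribute [instance] CovariantRep.cstar

/-- The C*-algebra of bounded families indexed by all covariant representations. -/
abbrev BoundedFamilies : Type (u + 1) := lp (fun r : X.CovariantRep => r.D) ∞

/-- The direct sum of all covariant representations, on `B`. -/
def sumπ : B →⋆ₙₐ[ℂ] X.BoundedFamilies where
  toFun b := ⟨fun r => r.rep.π b, memℓp_infty ⟨‖b‖, by
    rintro _ ⟨r, rfl⟩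
    exact NonUnitalStarAlgHom.norm_apply_le r.rep.π b⟩⟩
  map_smul' c b := by ext r; exact map_smul r.rep.π c b
  map_zero' := by ext r; exact map_zero r.rep.π
  map_add' a b := by ext r; exact map_add r.rep.π a b
  map_mul' a b := by ext r; exact map_mul r.rep.π a b
  map_star' b := by ext r; exact map_star r.rep.π b

/-- The direct sum of all covariant representations, on `X`. -/
def sumt : X →ₗ[ℂ] X.BoundedFamilies where
  toFun ξ := ⟨fun r => r.rep.t ξ, memℓp_infty ⟨√‖X.inner ξ ξ‖, by
    rintro _ ⟨r, rfl⟩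
    exact Real.le_sqrt_of_sq_le (r.rep.norm_t_sq_le ξ)⟩⟩
  map_smul' c b := by ext r; exact map_smul r.rep.t c b
  map_add' a b := by ext r; exact map_add r.rep.t a b

/-- The Cuntz--Pimsner algebra `O_X`: the C*-algebra generated by the direct sum of all covariant
representations of `X`. -/
def cuntzPimsner : NonUnitalStarSubalgebra ℂ X.BoundedFamilies :=
  (NonUnitalStarAlgebra.adjoin ℂ
    (Set.range X.sumπ ∪ Set.range X.sumt)).topologicalClosure

instance : NonUnitalCStarAlgebra X.cuntzPimsner :=
  NonUnitalStarSubalgebra.nonUnitalCStarAlgebra X.cuntzPimsner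
    (h_closed := NonUnitalStarSubalgebra.isClosed_topologicalClosure _)

/-- The universal covariant representation `(π_X, t_X)` of `X` in `O_X`. -/
def universalRep : X.ToeplitzRep X.cuntzPimsner where
  π := NonUnitalStarAlgHom.codRestrict X.sumπ X.cuntzPimsner fun b =>
    NonUnitalStarSubalgebra.le_topologicalClosure _
      (NonUnitalStarAlgebra.subset_adjoin ℂ _ (Or.inl ⟨b, rfl⟩))
  t :=
    { toFun := fun ξ => ⟨X.sumt ξ, NonUnitalStarSubalgebra.le_topologicalClosure _
        (NonUnitalStarAlgebra.subset_adjoin ℂ _ (Or.inr ⟨ξ, rfl⟩))⟩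
      map_add' := fun ξ η => Subtype.ext (map_add X.sumt ξ η)
      map_smul' := fun c ξ => Subtype.ext (map_smul X.sumt c ξ) }
  left_covariant b ξ := by
    apply Subtype.ext; ext r; exact r.rep.left_covariant b ξ
  star_t_mul_t ξ η := by
    apply Subtype.ext; ext r; exact r.rep.star_t_mul_t ξ η

theorem universalRep_isCovariant : X.universalRep.IsCovariant := by
  intro b hb n ξ η h
  apply Subtype.ext
  ext r
  have := r.covariant b hb n ξ η h
  have e : ((∑ i, X.universalRep.t (ξ i) * star (X.universalRep.t (η i)) :
      X.cuntzPimsner) : X.BoundedFamilies) r =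
      ∑ i, r.rep.t (ξ i) * star (r.rep.t (η i)) := by
    rw [AddSubmonoidClass.coe_finsetSum, lp.coeFn_sum, Finset.sum_apply]
    rfl
  rw [e]
  exact this

/-- Universality: each covariant representation factors through `(π_X, t_X)`. -/
theorem exists_hom_of_isCovariant {D : Type u} [NonUnitalCStarAlgebra D] (r : X.ToeplitzRep D)
    (hr : r.IsCovariant) : ∃ ρ : X.cuntzPimsner →⋆ₙₐ[ℂ] D,
      (∀ b, ρ (X.universalRep.π b) = r.π b) ∧ ∀ ξ, ρ (X.universalRep.t ξ) = r.t ξ :=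
  let i : X.CovariantRep := ⟨D, r, hr⟩
  ⟨{ toFun := fun a => (a : X.BoundedFamilies) i
     map_smul' := fun _ _ => rfl
     map_zero' := rfl
     map_add' := fun _ _ => rfl
     map_mul' := fun _ _ => rfl
     map_star' := fun _ => rfl }, fun _ => rfl, fun _ => rfl⟩

/-! ### Tensor powers and non-returning vectors -/

/-- A complex vector space with a left action of `B`. -/
structure LeftModule (B : Type u) [CStarAlgebra B] where
  carrier : Type u
  [addCommGroup : AddCommGroup carrier]
  [module : Module ℂ carrier]
  act : B →ₗ[ℂ] carrier →ₗ[ℂ] carrier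
  act_mul : ∀ a b ξ, act (a * b) ξ = act a (act b ξ)

attribute [instance] LeftModule.addCommGroup LeftModule.module

instance : CoeSort (LeftModule B) (Type u) := ⟨LeftModule.carrier⟩

/-- The relations `(x · b) ⊗ y = x ⊗ (b · y)` of the balanced tensor product. -/
def balancedRel (Y : LeftModule B) : Submodule ℂ (X ⊗[ℂ] Y) :=
  Submodule.span ℂ {z | ∃ (x : X) (b : B) (y : Y),
    z = X.right b x ⊗ₜ[ℂ] y - x ⊗ₜ[ℂ] Y.act b y}

theorem left_right (a b : B) (ξ : X) : X.left a (X.right b ξ) = X.right b (X.left a ξ) := by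
  rw [← sub_eq_zero]
  apply X.inner_self_eq_zero
  have h : ∀ η, X.inner η (X.left a (X.right b ξ)) = X.inner η (X.right b (X.left a ξ)) := by
    intro η
    have h1 := X.inner_left (star a) η (X.right b ξ)
    have h2 := X.inner_left (star a) η ξ
    rw [star_star] at h1 h2
    rw [← h1, X.inner_right, X.inner_right, h2]
  rw [map_sub, sub_eq_zero]
  exact h _

theorem balancedRel_le_comap (Y : LeftModule B) (b : B) :
    X.balancedRel Y ≤ (X.balancedRel Y).comap ((X.left b).rTensor Y) := by
  refine Submodule.span_le.2 ?_
  rintro _ ⟨x, a, y, rfl⟩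
  refine Submodule.subset_span ⟨X.left b x, a, y, ?_⟩
  simp [X.left_right]

/-- The action `b · (x ⊗ y) = (b · x) ⊗ y` on the balanced tensor product. -/
def tensorAct (Y : LeftModule B) :
    B →ₗ[ℂ] ((X ⊗[ℂ] Y) ⧸ X.balancedRel Y) →ₗ[ℂ] ((X ⊗[ℂ] Y) ⧸ X.balancedRel Y) where
  toFun b := (X.balancedRel Y).mapQ (X.balancedRel Y) ((X.left b).rTensor Y)
    (X.balancedRel_le_comap Y b)
  map_add' a b := by
    apply Submodule.linearMap_qext
    ext x y
    simp
  map_smul' c b := by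
    apply Submodule.linearMap_qext
    ext x y
    simp

/-- The balanced tensor product `X ⊗_B Y` with the left action on the first factor. (In finite
dimension the canonical `B`-valued form on the balanced tensor product of two correspondences is
definite and complete, so this is the underlying space of the tensor product of
C*-correspondences.) -/
def tensor (Y : LeftModule B) : LeftModule B where
  carrier := (X ⊗[ℂ] Y) ⧸ X.balancedRel Y
  act := X.tensorAct Y
  act_mul a b ξ := by
    have h : X.left (a * b) = X.left a ∘ₗ X.left b := LinearMap.ext (X.left_mul a b)
    obtain ⟨z, rfl⟩ := Submodule.Quotient.mk_surjective _ ξ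
    simp [tensorAct, h, ← LinearMap.rTensor_comp_apply]

/-- The elementary tensor `x ⊗ y` in `X ⊗_B Y`. -/
def tmul {Y : LeftModule B} (x : X) (y : Y) : X.tensor Y :=
  Submodule.Quotient.mk (p := X.balancedRel Y) (x ⊗ₜ[ℂ] y)

/-- The tensor powers `X^{⊗0} = B`, `X^{⊗1} = X`, `X^{⊗(n+1)} = X ⊗_B X^{⊗n}`. -/
def tensorPow : ℕ → LeftModule B
  | 0 => { carrier := B, act := LinearMap.mul ℂ B, act_mul := fun a b c => mul_assoc a b c }
  | 1 => { carrier := X, act := X.left, act_mul := X.left_mul }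
  | n + 2 => X.tensor (tensorPow (n + 1))

/-- The elementary tensor `ξ₀ ⊗ ⋯ ⊗ ξₙ` in `X^{⊗(n+1)}`. -/
def elementary : (n : ℕ) → (Fin (n + 1) → X) → X.tensorPow (n + 1)
  | 0, ξ => ξ 0
  | n + 1, ξ => X.tmul (ξ 0) (elementary n (Fin.tail ξ))

namespace ToeplitzRep

variable {X} {D : Type v} [NonUnitalCStarAlgebra D] (r : X.ToeplitzRep D)

/-- For `f : Y → D` compatible with the left action, the map `x ⊗ y ↦ t(x) f(y)` on `X ⊗_B Y`. -/
def tensorLift {Y : LeftModule B} (f : Y →ₗ[ℂ] D) (hf : ∀ b y, f (Y.act b y) = r.π b * f y) :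
    X.tensor Y →ₗ[ℂ] D :=
  (X.balancedRel Y).liftQ (TensorProduct.lift ((LinearMap.mul ℂ D).compl₁₂ r.t f)) <| by
    refine Submodule.span_le.2 ?_
    rintro _ ⟨x, b, y, rfl⟩
    simp [hf, ← r.t_mul_π, mul_assoc]

theorem tensorLift_act {Y : LeftModule B} (f : Y →ₗ[ℂ] D)
    (hf : ∀ b y, f (Y.act b y) = r.π b * f y) (b : B) (ξ : X.tensor Y) :
    r.tensorLift f hf ((X.tensor Y).act b ξ) = r.π b * r.tensorLift f hf ξ := by
  have h : (r.tensorLift f hf : ((X ⊗[ℂ] Y) ⧸ X.balancedRel Y) →ₗ[ℂ] D) ∘ₗ X.tensorAct Y b =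
      LinearMap.mulLeft ℂ (r.π b) ∘ₗ r.tensorLift f hf := by
    apply Submodule.linearMap_qext
    ext x y
    change r.t (X.left b x) * f y = r.π b * (r.t x * f y)
    rw [← r.left_covariant, mul_assoc]
  exact LinearMap.congr_fun h ξ

/-- The maps `t^n : X^{⊗n} → D`, with the fact that they respect the left action. -/
def tPowAux : (n : ℕ) →
    {f : X.tensorPow n →ₗ[ℂ] D // ∀ b ξ, f ((X.tensorPow n).act b ξ) = r.π b * f ξ}
  | 0 => ⟨(r.π : B →ₗ[ℂ] D), fun a b => map_mul r.π a b⟩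
  | 1 => ⟨r.t, fun b ξ => (r.left_covariant b ξ).symm⟩
  | n + 2 => ⟨r.tensorLift (tPowAux (n + 1)).1 (tPowAux (n + 1)).2,
      r.tensorLift_act (tPowAux (n + 1)).1 (tPowAux (n + 1)).2⟩

/-- The map `t^n : X^{⊗n} → D`: `t^0 = π`, `t^1 = t` and `t^(n+1)(x ⊗ ξ) = t(x) t^n(ξ)`. -/
def tPow (n : ℕ) : X.tensorPow n →ₗ[ℂ] D := (r.tPowAux n).1

end ToeplitzRep

/-- A vector `ξ ∈ X^{⊗m}` is non-returning if `t^m(ξ)* t^n(η) t^m(ξ) = 0` in `O_X` for all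
`0 < n < m` and all `η ∈ X^{⊗n}`, where `(π, t)` is the universal covariant representation. -/
def IsNonReturning {m : ℕ} (ξ : X.tensorPow m) : Prop :=
  ∀ n, 0 < n → n < m → ∀ η : X.tensorPow n,
    star (X.universalRep.tPow m ξ) * X.universalRep.tPow n η * X.universalRep.tPow m ξ = 0

end Correspondence

/-! ## Quantum graphs -/

section QuantumGraph

variable {B : Type u} [CStarAlgebra B] [PartialOrder B] [StarOrderedRing B]

/-- A faithful state on `B`. -/
structure FaithfulState (B : Type u) [CStarAlgebra B] [PartialOrder B] where
  toMap : B →ₚ[ℂ] ℂ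
  map_one : toMap 1 = 1
  faithful : ∀ x, toMap (star x * x) = 0 → x = 0

namespace FaithfulState

set_option linter.unusedVariables false in
/-- The space `L²(B, ψ)`: the vector space `B` with the inner product `⟨x, y⟩ = ψ(x* y)`. -/
def L2 (ψ : FaithfulState B) : Type u := B

variable (ψ : FaithfulState B)

instance : AddCommGroup ψ.L2 := inferInstanceAs (AddCommGroup B)
instance : Module ℂ ψ.L2 := inferInstanceAs (Module ℂ B)
instance [FiniteDimensional ℂ B] : FiniteDimensional ℂ ψ.L2 :=
  inferInstanceAs (FiniteDimensional ℂ B)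

/-- The identity map from `B` to `L²(B, ψ)`. -/
def toL2 : B ≃ₗ[ℂ] ψ.L2 := LinearEquiv.refl ℂ B

/-- The inner product `⟨x, y⟩ = ψ(x* y)`. -/
abbrev innerCore : InnerProductSpace.Core ℂ ψ.L2 where
  inner x y := ψ.toMap (star (ψ.toL2.symm x) * ψ.toL2.symm y)
  conj_inner_symm := by simp [← Complex.star_def, ← map_star ψ.toMap]
  re_inner_nonneg _ :=
    (RCLike.nonneg_iff.mp (ψ.toMap.map_nonneg (star_mul_self_nonneg _))).1
  add_left _ _ _ := by rw [map_add, star_add, add_mul, map_add]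
  smul_left := by simp
  definite x h := by simpa using ψ.faithful _ h

instance : NormedAddCommGroup ψ.L2 := ψ.innerCore.toNormedAddCommGroup
instance : InnerProductSpace ℂ ψ.L2 := InnerProductSpace.ofCore ψ.innerCore.toCore

theorem inner_L2 (x y : B) : inner ℂ (ψ.toL2 x) (ψ.toL2 y) = ψ.toMap (star x * y) := rfl

/-- The multiplication `m : L²(B ⊗ B, ψ ⊗ ψ) → L²(B, ψ)`. -/
def mulL2 : ψ.L2 ⊗[ℂ] ψ.L2 →ₗ[ℂ] ψ.L2 :=
  ψ.toL2.toLinearMap ∘ₗ LinearMap.mul' ℂ B ∘ₗ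
    TensorProduct.map ψ.toL2.symm.toLinearMap ψ.toL2.symm.toLinearMap

/-- The Hermitian adjoint `m*`, as a map `B → B ⊗ B`. -/
def mulAdjoint [FiniteDimensional ℂ B] : B →ₗ[ℂ] B ⊗[ℂ] B :=
  TensorProduct.map ψ.toL2.symm.toLinearMap ψ.toL2.symm.toLinearMap ∘ₗ
    LinearMap.adjoint ψ.mulL2 ∘ₗ ψ.toL2.toLinearMap

/-! ### The correspondence `B ⊗_ψ B` -/

/-- The map `ψ ⊗ id : B ⊗ B → B`. -/
def slice : B ⊗[ℂ] B →ₗ[ℂ] B :=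
  (TensorProduct.lid ℂ B).toLinearMap ∘ₗ (ψ.toMap.toLinearMap).rTensor B

/-- The `B`-valued inner product of `B ⊗_ψ B`, namely `⟨u | v⟩ = (ψ ⊗ id)(u* v)`, that is
`⟨x ⊗ y | z ⊗ w⟩ = ψ(x* z) y* w`. -/
def innerB : B ⊗[ℂ] B →ₗ⋆[ℂ] B ⊗[ℂ] B →ₗ[ℂ] B where
  toFun u := ψ.slice ∘ₗ LinearMap.mulLeft ℂ (star u)
  map_add' u v := by ext; simp [add_mul]
  map_smul' c u := by ext; simp

theorem innerB_tmul (x y z w : B) :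
    ψ.innerB (x ⊗ₜ y) (z ⊗ₜ w) = ψ.toMap (star x * z) • (star y * w) := by
  simp [innerB, slice]

theorem star_innerB (u v : B ⊗[ℂ] B) : star (ψ.innerB u v) = ψ.innerB v u := by
  induction u using TensorProduct.induction_on with
  | zero => simp
  | add a b ha hb => simp [ha, hb]
  | tmul x y =>
    induction v using TensorProduct.induction_on with
    | zero => simp
    | add a b ha hb => simp [ha, hb]
    | tmul z w =>
      rw [innerB_tmul, innerB_tmul, star_smul, ← map_star ψ.toMap]
      simp

theorem innerB_self [FiniteDimensional ℂ B] (u : B ⊗[ℂ] B) :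
    0 ≤ ψ.innerB u u ∧ (ψ.innerB u u = 0 → u = 0) := by
  let e := stdOrthonormalBasis ℂ ψ.L2
  have hu : ∃ y : Fin (Module.finrank ℂ ψ.L2) → B, u = ∑ i, ψ.toL2.symm (e i) ⊗ₜ[ℂ] y i := by
    induction u using TensorProduct.induction_on with
    | zero => exact ⟨0, by simp⟩
    | add a b ha hb =>
      obtain ⟨y, rfl⟩ := ha
      obtain ⟨z, rfl⟩ := hb
      exact ⟨y + z, by simp [TensorProduct.tmul_add, Finset.sum_add_distrib]⟩
    | tmul x y =>
      refine ⟨fun i => e.repr (ψ.toL2 x) i • y, ?_⟩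
      have : x = ψ.toL2.symm (∑ i, e.repr (ψ.toL2 x) i • e i) := by
        rw [e.sum_repr]; simp
      conv_lhs => rw [this]
      simp only [map_sum, map_smul, TensorProduct.sum_tmul, TensorProduct.smul_tmul]
  obtain ⟨y, rfl⟩ := hu
  have key : ψ.innerB (∑ i, ψ.toL2.symm (e i) ⊗ₜ[ℂ] y i) (∑ i, ψ.toL2.symm (e i) ⊗ₜ[ℂ] y i) =
      ∑ i, star (y i) * y i := by
    have h : ∀ i j, ψ.toMap (star (ψ.toL2.symm (e i)) * ψ.toL2.symm (e j)) =
        if i = j then 1 else 0 := fun i j => by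
      rw [← orthonormal_iff_ite.1 e.orthonormal i j]; rfl
    simp [innerB_tmul, h]
  rw [key]
  have hn : ∀ i, 0 ≤ star (y i) * y i := fun i => star_mul_self_nonneg _
  refine ⟨Finset.sum_nonneg fun i _ => hn i, fun h0 => ?_⟩
  have := (Finset.sum_eq_zero_iff_of_nonneg fun i _ => hn i).1 h0
  refine Finset.sum_eq_zero fun i hi => ?_
  rw [(CStarRing.star_mul_self_eq_zero_iff _).1 (this i hi), TensorProduct.tmul_zero]

/-- The correspondence `B ⊗_ψ B`, with `a · (x ⊗ y) = (a x) ⊗ y`, `(x ⊗ y) · b = x ⊗ (y b)` and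
`⟨x ⊗ y | z ⊗ w⟩ = ψ(x* z) y* w`. -/
def tensorCorrespondence [FiniteDimensional ℂ B] : Correspondence B where
  carrier := B ⊗[ℂ] B
  left := LinearMap.rTensorHom B ∘ₗ LinearMap.mul ℂ B
  right := LinearMap.lTensorHom B ∘ₗ (LinearMap.mul ℂ B).flip
  inner := ψ.innerB
  left_mul a b ξ := by
    induction ξ using TensorProduct.induction_on with
    | zero => simp
    | add u v hu hv => simp only [map_add, hu, hv]
    | tmul x y => simp [mul_assoc]
  right_mul a b ξ := by
    induction ξ using TensorProduct.induction_on with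
    | zero => simp
    | add u v hu hv => simp only [map_add, hu, hv]
    | tmul x y => simp [mul_assoc]
  right_one ξ := by
    induction ξ using TensorProduct.induction_on with
    | zero => simp
    | add u v hu hv => simp only [map_add, hu, hv]
    | tmul x y => simp
  inner_right ξ η b := by
    induction ξ using TensorProduct.induction_on with
    | zero => simp
    | add u v hu hv => simp only [map_add, LinearMap.add_apply, hu, hv, add_mul]
    | tmul x y =>
      induction η using TensorProduct.induction_on with
      | zero => simp
      | add u v hu hv => simp only [map_add, hu, hv, add_mul]
      | tmul z w => simp [innerB_tmul, mul_assoc]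
  star_inner := ψ.star_innerB
  inner_self_nonneg u := (ψ.innerB_self u).1
  inner_self_eq_zero u := (ψ.innerB_self u).2
  inner_left b ξ η := by
    induction ξ using TensorProduct.induction_on with
    | zero => simp
    | add u v hu hv => simp only [map_add, LinearMap.add_apply, hu, hv]
    | tmul x y =>
      induction η using TensorProduct.induction_on with
      | zero => simp
      | add u v hu hv => simp only [map_add, hu, hv]
      | tmul z w => simp [innerB_tmul, mul_assoc]

end FaithfulState

namespace Correspondence

/-- The subcorrespondence of `X` on a subspace invariant under both actions, with the inherited
actions and inner product. -/
def sub (X : Correspondence B) (S : Submodule ℂ X) (hl : ∀ b, ∀ ξ ∈ S, X.left b ξ ∈ S)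
    (hr : ∀ b, ∀ ξ ∈ S, X.right b ξ ∈ S) : Correspondence B where
  carrier := S
  left :=
    { toFun := fun b => (X.left b).restrict (hl b)
      map_add' := fun a b => by ext; simp
      map_smul' := fun c b => by ext; simp }
  right :=
    { toFun := fun b => (X.right b).restrict (hr b)
      map_add' := fun a b => by ext; simp
      map_smul' := fun c b => by ext; simp }
  inner := (X.inner.compl₂ S.subtype).comp S.subtype
  left_mul a b ξ := Subtype.ext (X.left_mul a b ξ)
  right_mul a b ξ := Subtype.ext (X.right_mul a b ξ)
  right_one ξ := Subtype.ext (X.right_one ξ)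
  inner_right ξ η b := X.inner_right ξ η b
  star_inner ξ η := X.star_inner ξ η
  inner_self_nonneg ξ := X.inner_self_nonneg ξ
  inner_self_eq_zero ξ h := Subtype.ext (X.inner_self_eq_zero ξ h)
  inner_left b ξ η := X.inner_left b ξ η

/-- The `B`-`B`-subcorrespondence `span {x · ζ · y : x, y ∈ B}` generated by a vector `ζ`. -/
def cyclic (X : Correspondence B) (ζ : X) : Correspondence B :=
  X.sub (Submodule.span ℂ {ξ | ∃ x y : B, ξ = X.right y (X.left x ζ)})
    (fun b ξ hξ => by
      induction hξ using Submodule.span_induction with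
      | mem ξ h =>
        obtain ⟨x, y, rfl⟩ := h
        exact Submodule.subset_span ⟨b * x, y, by rw [X.left_mul, X.left_right]⟩
      | zero => simp
      | add u v _ _ hu hv => rw [map_add]; exact Submodule.add_mem _ hu hv
      | smul c u _ hu => rw [map_smul]; exact Submodule.smul_mem _ c hu)
    (fun b ξ hξ => by
      induction hξ using Submodule.span_induction with
      | mem ξ h =>
        obtain ⟨x, y, rfl⟩ := h
        exact Submodule.subset_span ⟨x, y * b, by rw [X.right_mul]⟩
      | zero => simp
      | add u v _ _ hu hv => rw [map_add]; exact Submodule.add_mem _ hu hv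
      | smul c u _ hu => rw [map_smul]; exact Submodule.smul_mem _ c hu)

end Correspondence

/-- A finite quantum graph `(B, ψ, A)`: a state `ψ` on the finite-dimensional C*-algebra `B` which
is a `δ`-form, i.e. `m m* = δ² id`, and a completely positive map `A : B → B` which is quantum Schur
idempotent, i.e. `m (A ⊗ A) m* = δ² A`. -/
structure QuantumGraph (B : Type u) [CStarAlgebra B] [PartialOrder B] [StarOrderedRing B]
    [FiniteDimensional ℂ B] where
  ψ : FaithfulState B
  δ : ℝ
  δ_pos : 0 < δ
  isDeltaForm : LinearMap.mul' ℂ B ∘ₗ ψ.mulAdjoint = ((δ : ℂ) ^ 2) • LinearMap.id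
  A : CompletelyPositiveMap B B
  isSchurIdempotent : LinearMap.mul' ℂ B ∘ₗ
    TensorProduct.map A.toLinearMap A.toLinearMap ∘ₗ ψ.mulAdjoint = ((δ : ℂ) ^ 2) • A.toLinearMap

namespace QuantumGraph

variable [FiniteDimensional ℂ B] (G : QuantumGraph B)

/-- The element `ε = δ⁻² (id ⊗ A) m*(1)` of `B ⊗ B`. -/
def edgeTensor : B ⊗[ℂ] B :=
  ((G.δ : ℂ) ^ 2)⁻¹ • (G.A.toLinearMap).lTensor B (G.ψ.mulAdjoint 1)

/-- The quantum edge correspondence `E = span {x · ε · y : x, y ∈ B}` inside `B ⊗_ψ B`. -/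
def edgeCorrespondence : Correspondence B :=
  G.ψ.tensorCorrespondence.cyclic G.edgeTensor

/-- The vector `ε`, as an element of the quantum edge correspondence. -/
def edgeVector : G.edgeCorrespondence :=
  ⟨G.edgeTensor, Submodule.subset_span ⟨1, 1, by
    rw [Correspondence.right_one]
    change G.edgeTensor = (LinearMap.mul ℂ B 1).rTensor B G.edgeTensor
    rw [show LinearMap.mul ℂ B 1 = LinearMap.id from by ext; simp, LinearMap.rTensor_id,
      LinearMap.id_apply]⟩⟩

end QuantumGraph

end QuantumGraph

end

/-! ### Right annihilators of cyclic subcorrespondences. -/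

namespace Correspondence

variable {B : Type u} [CStarAlgebra B] [PartialOrder B] [StarOrderedRing B] {X : Correspondence B}

/-! The edge vector lies in `B ⊗ A(B)`, and `c` is central and orthogonal to the range of `A`, so
`(x ⊗ A y) · c = x ⊗ c A(y) = 0`. Hence `E · c = 0` for the whole edge correspondence `E`
(`edgeCorrespondence_right_eq_zero`): no edge ends at the vertices carried by `c`.

The given tensor starts with `c · ε`, and `t(ζ) t(c · ε) = t(ζ) π(c) t(ε) = t(ζ · c) t(ε) = 0` for
every `ζ` in `E` (`t_mul_tPow_elementary_cons_eq_zero`). For `n ≥ 1`, `t^n(η)` is a sum of products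
whose last factor lies in `t(E)`, so `t^n(η) t^m(ξ)` is already zero (`tPow_succ_mul_eq_zero`). In
graph terms, a path leaving a source cannot be preceded by another edge. -/

/-- If `b` commutes with `B` and annihilates `ζ` on the right, then it annihilates the
subcorrespondence generated by `ζ`. -/
theorem cyclic_right_eq_zero (ζ : X) (b : B) (hb : ∀ a, b * a = a * b)
    (hζ : X.right b ζ = 0) (ξ : X.cyclic ζ) : (X.cyclic ζ).right b ξ = 0 := by
  obtain ⟨ξ, hξ⟩ := ξ
  apply Subtype.ext
  change X.right b ξ = 0
  induction hξ using Submodule.span_induction with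
  | mem ξ h =>
    obtain ⟨x, y, rfl⟩ := h
    -- By centrality `b` moves past `y`, then past the left action of `x`: `(x · ζ · y) · b = (x ·
    -- (ζ · b)) · y`.
    rw [← X.right_mul, ← hb, X.right_mul, ← X.left_right, hζ, map_zero, map_zero]
  | zero => exact map_zero _
  | add u v _ _ hu hv => rw [map_add, hu, hv, add_zero]
  | smul a u _ hu => rw [map_smul, hu, smul_zero]

/-! ### Products of images of tensor powers in a Toeplitz representation. -/

namespace ToeplitzRep

variable {D : Type v} [NonUnitalCStarAlgebra D] (r : X.ToeplitzRep D)

/-- An element of `D` annihilated by `t(X)` on the left is annihilated by `t^(n+1)(X^{⊗(n+1)})`. -/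
theorem tPow_succ_mul_eq_zero {d : D} (hd : ∀ ξ, r.t ξ * d = 0) (n : ℕ)
    (η : X.tensorPow (n + 1)) : r.tPow (n + 1) η * d = 0 := by
  induction n with
  | zero => exact hd η
  | succ n ih =>
    -- `X.tensorPow (n + 2)` unfolds to the balanced tensor product, so linearity reduces the claim
    -- to classes of simple tensors. The additive cases are given as terms, which are checked up to
    -- this unfolding.
    obtain ⟨z, rfl⟩ := Submodule.Quotient.mk_surjective _ η
    induction z using TensorProduct.induction_on with
    | zero => exact (congrArg (· * d) (map_zero (r.tPow (n + 2)))).trans (zero_mul d)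
    | add u v hu hv =>
      have h := map_add (r.tPow (n + 2)) (Submodule.Quotient.mk u) (Submodule.Quotient.mk v)
      exact (congrArg (· * d) h).trans
        ((add_mul _ _ d).trans ((congrArg₂ (· + ·) hu hv).trans (add_zero 0)))
    | tmul x y =>
      -- By definition `t^(n+2)(x ⊗ y) = t(x) t^(n+1)(y)`; the shorter factor `t^(n+1)(y)`, adjacent
      -- to `d`, already kills it.
      change r.t x * r.tPow (n + 1) y * d = 0
      rw [mul_assoc, ih, mul_zero]

/-- If `X · b = 0`, then `t(X)` annihilates the elementary tensors beginning with `b · ξ`. -/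
theorem t_mul_tPow_elementary_cons_eq_zero {b : B} (hb : ∀ ξ, X.right b ξ = 0) (ξ ζ : X) (k : ℕ)
    (η : Fin k → X) :
    r.t ζ * r.tPow (k + 1) (X.elementary k (Fin.cons (X.left b ξ) η)) = 0 := by
  have h : r.t ζ * r.t (X.left b ξ) = 0 := by
    rw [← r.left_covariant, ← mul_assoc, r.t_mul_π, hb, map_zero, zero_mul]
  -- `elementary` and `tPow` treat length one separately: there the image is `t(b · ξ)` itself,
  -- while for longer tensors it splits off as the first factor.
  cases k with
  | zero => exact h
  | succ k =>
    change r.t ζ * (r.t (X.left b ξ) * r.tPow (k + 1) (X.elementary k η)) = 0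
    rw [← mul_assoc, h, zero_mul]

end ToeplitzRep

end Correspondence

/-! ### The edge correspondence and its non-returning vectors. -/

namespace QuantumGraph

variable {B : Type u} [CStarAlgebra B] [PartialOrder B] [StarOrderedRing B]
  [FiniteDimensional ℂ B] (G : QuantumGraph B)

/-- Since `ε` generates the edge correspondence and `c` is central, it suffices that `ε · c = 0`.
The right action touches only the second leg of `ε`, which lies in the range of `A`. -/
theorem edgeCorrespondence_right_eq_zero {c : B} (hcentral : ∀ b : B, c * b = b * c)
    (horth : ∀ b : B, c * G.A b = 0) (ξ : G.edgeCorrespondence) :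
    G.edgeCorrespondence.right c ξ = 0 := by
  refine Correspondence.cyclic_right_eq_zero (X := G.ψ.tensorCorrespondence) _ c hcentral ?_ ξ
  -- This holds on all of `B ⊗ B`, so nothing about `m*(1)` has to be computed.
  have h : ((LinearMap.mul ℂ B).flip c).lTensor B ∘ₗ (G.A.toLinearMap).lTensor B = 0 := by
    ext x y
    change x ⊗ₜ[ℂ] (G.A y * c) = 0
    rw [← hcentral, horth, TensorProduct.tmul_zero]
  change ((LinearMap.mul ℂ B).flip c).lTensor B G.edgeTensor = 0
  rw [edgeTensor, map_smul]
  exact (congrArg _ (LinearMap.congr_fun h _)).trans (smul_zero _)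

end QuantumGraph

theorem mainTheorem11 {B : Type u} [CStarAlgebra B] [PartialOrder B] [StarOrderedRing B]
    [FiniteDimensional ℂ B] (G : QuantumGraph B) (c : B) (hc : IsStarProjection c)
    (hcentral : ∀ b : B, c * b = b * c) (horth : ∀ b : B, c * G.A b = 0) (k : ℕ) :
    G.edgeCorrespondence.IsNonReturning (m := k + 1)
      (G.edgeCorrespondence.elementary k
        (Fin.cons (G.edgeCorrespondence.left c G.edgeVector) fun _ => G.edgeVector)) := by
  intro n hn _ η
  -- Positivity of `n` guarantees a last factor in `t(E)` next to `t^m(ξ)`; for `n = 0` the middle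
  -- term would be `π(η)`.
  obtain ⟨n, rfl⟩ := Nat.exists_eq_add_one.2 hn
  -- Here `d` is `t^m(ξ)`; that `t(E)` annihilates it is the remaining goal.
  rw [mul_assoc, Correspondence.ToeplitzRep.tPow_succ_mul_eq_zero, mul_zero]
  exact fun ζ => Correspondence.ToeplitzRep.t_mul_tPow_elementary_cons_eq_zero _
    (G.edgeCorrespondence_right_eq_zero hcentral horth) _ ζ k _
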